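/- Let $b\ge 2$ be an integer and let $A=(a_n)_{n\ge1}$ be a strictly increasing sequence of positive integers such that the limit $\eta:=\lim_{n\to\infty} a_{n+1}/a_n$ exists and $1<\eta<\infty$. Write $\|x\|$ for the distance from a real number $x$ to the nearest integer. For an irrational real number $\xi$, let $\hat v_{b,A}(\xi)$ be the supremum (in $[0,\infty]$) of the real numbers $\hat w\ge 0$ such that, for every sufficiently large integer $N$, $$\min_{1\le n\le N}\|b^{a_n}\xi\|<(b^{a_N})^{-\hat w}.$$ Then for every $\hat v\in(0,\eta)$, $$\dim_{\rm H}\{\xi\in\mathbb R\setminus\mathbb Q:\ \hat v_{b,A}(\xi)=\hat v\}\ \ge\ \frac{\eta^{\tilde l+1}-1-\eta^{\tilde l}\hat v}{(\eta^{\tilde l+1}-1)(1+\eta^{\tilde l}\hat v)},\qquad \tilde l=\max\left\{1,\left\lfloor\frac{\log(\eta+1)-\log(\eta-\hat v)}{\log\eta}\right\rfloor\right\},$$ where $\dim_{\rm H}$ denotes the Hausdorff dimension. -/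

import Mathlib

open Filter Topology
open scoped NNReal ENNReal

/-- The distance from a real number to the nearest integer. -/
noncomputable def distNearestInt (x : ℝ) : ℝ := |x - (round x : ℝ)|

/-- The uniform exponent of `ξ` with respect to the base `b` and the sequence `a`: the supremum,
in `[0, ∞]`, of the real numbers `v ≥ 0` such that for every sufficiently large `N` some term
`a n` with `n ≤ N` satisfies `‖b ^ (a n) ξ‖ < (b ^ (a N)) ^ (-v)`.
The sequence is indexed from `0`, so `a 0` is its first term. -/
noncomputable def uniformExponent (b : ℕ) (a : ℕ → ℕ) (ξ : ℝ) : ℝ≥0∞ :=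
  ⨆ (v : ℝ≥0) (_ : ∀ᶠ N : ℕ in atTop, ∃ n ≤ N,
      distNearestInt ((b : ℝ) ^ a n * ξ) < ((b : ℝ) ^ a N) ^ (-(v : ℝ))), (v : ℝ≥0∞)

/-- The set of the irrational real numbers whose uniform exponent is exactly `v`. -/
def uniformExponentLevelSet (b : ℕ) (a : ℕ → ℕ) (v : ℝ≥0∞) : Set ℝ :=
  {ξ : ℝ | Irrational ξ ∧ uniformExponent b a ξ = v}

/-- The index `max {1, ⌊(log (η + 1) - log (η - v)) / log η⌋}`. The floor in `ℕ` differs from the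
one in `ℤ` only at negative arguments, where the maximum is `1` for both. -/
noncomputable def lTilde (η v : ℝ) : ℕ :=
  max 1 ⌊(Real.log (η + 1) - Real.log (η - v)) / Real.log η⌋₊

/-! Group the indices into blocks of `l + 1` consecutive terms. For the first index `n` of each late
block, force the base-`b` digits of `ξ` to vanish from position `a n` to about `a n + v * a (n +
l)`. Then `b ^ a n * ξ` is so close to an integer that this single `n` serves every `N` of the
block, and the exponent is at least `v`. Outside these gaps each period of `M` digits contains a
forced `1` and a forced `0`, so the distances up to the end of a block are bounded below by the
length of its gap, up to a constant factor; hence the exponent is at most `v`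
(`le_distNearestInt_fillDigits`, `uniformExponent_eq_of_approximation`).

All other digits are arbitrary. Reading them off is a map onto `[0, 1]`, Hölder of any positive
exponent `s` that bounds their density from below, so the set has dimension at least `s`
(`le_dimH_range_fillDigits`). The density is governed by the ratio of the stretch between two gaps
to the distance between their ends. Since `a (n + j) / a n` tends to `η ^ j`, this ratio tends to
the stated quotient, and the forced digits cost only a factor `(M - 2) / M`. A large `M` reaches
every `s` below the quotient. The argument works for every `l`. -/

/-! ### Base-`b` digits and distances to integers -/

section Digits

variable {b : ℕ}

lemma ofDigits_ge_of_ne_zero (d : ℕ → Fin b) {i : ℕ} (h : (d i : ℕ) ≠ 0) :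
    ((b : ℝ) ^ (i + 1))⁻¹ ≤ Real.ofDigits d := by
  have h1 : (1 : ℝ) ≤ (d i : ℕ) := by exact_mod_cast Nat.one_le_iff_ne_zero.2 h
  calc ((b : ℝ) ^ (i + 1))⁻¹ ≤ (d i : ℕ) * ((b : ℝ) ^ (i + 1))⁻¹ :=
        le_mul_of_one_le_left (by positivity) h1
    _ ≤ Real.ofDigits d :=
        Real.summable_ofDigitsTerm.le_tsum i fun _ _ => Real.ofDigitsTerm_nonneg

lemma ofDigits_le_of_eq_zero (hb : 2 ≤ b) (d : ℕ → Fin b) {i : ℕ} (h : (d i : ℕ) = 0) :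
    Real.ofDigits d ≤ 1 - ((b : ℝ) ^ (i + 1))⁻¹ := by
  -- Raising digit `i` from `0` to `1` adds exactly `b ^ -(i + 1)`, and the result is still at most
  -- `1`.
  set e : ℕ → Fin b := Function.update d i ⟨1, hb⟩ with he
  have h1 := Real.ofDigits_le_one e
  rw [Real.ofDigits_eq_sum_add_ofDigits e (i + 1), Finset.sum_range_succ] at h1
  rw [Real.ofDigits_eq_sum_add_ofDigits d (i + 1), Finset.sum_range_succ]
  have h2 : ∑ j ∈ Finset.range i, Real.ofDigitsTerm e j =
      ∑ j ∈ Finset.range i, Real.ofDigitsTerm d j :=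
    Finset.sum_congr rfl fun j hj => by
      simp [Real.ofDigitsTerm, he, Function.update_of_ne (Finset.mem_range.1 hj).ne]
  have h3 : (fun j => e (j + (i + 1))) = fun j => d (j + (i + 1)) := by
    funext j
    exact Function.update_of_ne (by omega) _ _
  have h4 : Real.ofDigitsTerm e i = ((b : ℝ) ^ (i + 1))⁻¹ := by simp [Real.ofDigitsTerm, he]
  have h5 : Real.ofDigitsTerm d i = 0 := by simp [Real.ofDigitsTerm, h]
  rw [h2, h3, h4] at h1
  rw [h5]
  linarith

lemma ofDigits_le_of_forall_lt_eq_zero (d : ℕ → Fin b) {m : ℕ}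
    (h : ∀ i < m, (d i : ℕ) = 0) : Real.ofDigits d ≤ ((b : ℝ) ^ m)⁻¹ := by
  rw [Real.ofDigits_eq_sum_add_ofDigits d m, Finset.sum_eq_zero, zero_add]
  · exact mul_le_of_le_one_right (by positivity) (Real.ofDigits_le_one _)
  · intro i hi
    simp [Real.ofDigitsTerm, h i (Finset.mem_range.1 hi)]

lemma exists_int_pow_mul_ofDigits (hb : 0 < b) (d : ℕ → Fin b) (n : ℕ) :
    ∃ z : ℤ, (b : ℝ) ^ n * Real.ofDigits d = z + Real.ofDigits fun i => d (i + n) := by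
  have hb' : (b : ℝ) ≠ 0 := by positivity
  refine ⟨∑ i ∈ Finset.range n, (d i : ℕ) * (b : ℤ) ^ (n - (i + 1)), ?_⟩
  rw [Real.ofDigits_eq_sum_add_ofDigits d n, mul_add, mul_inv_cancel_left₀ (by positivity),
    Finset.mul_sum]
  congr 1
  push_cast
  refine Finset.sum_congr rfl fun i hi => ?_
  have hi' : i + 1 ≤ n := Finset.mem_range.1 hi
  rw [Real.ofDigitsTerm, mul_left_comm, pow_sub₀ _ hb' hi']

lemma distNearestInt_pow_mul_ofDigits_le (hb : 0 < b) (d : ℕ → Fin b) (n : ℕ) :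
    distNearestInt ((b : ℝ) ^ n * Real.ofDigits d) ≤ Real.ofDigits fun i => d (i + n) := by
  obtain ⟨z, hz⟩ := exists_int_pow_mul_ofDigits hb d n
  refine (round_le _ z).trans_eq ?_
  rw [hz, add_sub_cancel_left, abs_of_nonneg (Real.ofDigits_nonneg _)]

lemma le_distNearestInt_int_add {c y : ℝ} (hc : 0 < c) (z : ℤ) (h₁ : c ≤ y) (h₂ : y ≤ 1 - c) :
    c ≤ distNearestInt (z + y) := by
  have hf : Int.fract ((z : ℝ) + y) = y := by
    rw [Int.fract_intCast_add, Int.fract_eq_self]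
    constructor <;> linarith
  rw [distNearestInt, abs_sub_round_eq_min, hf]
  exact le_min h₁ (by linarith)

/-- In the window of `T` digits after the shift, a nonzero digit keeps the fractional part away from
`0` and a zero digit keeps it away from `1`. -/
lemma le_distNearestInt_pow_mul_ofDigits (hb : 2 ≤ b) (d : ℕ → Fin b) (n T : ℕ)
    (h₀ : ∃ i, n ≤ i ∧ i < n + T ∧ (d i : ℕ) = 0)
    (h₁ : ∃ i, n ≤ i ∧ i < n + T ∧ (d i : ℕ) ≠ 0) :
    ((b : ℝ) ^ T)⁻¹ ≤ distNearestInt ((b : ℝ) ^ n * Real.ofDigits d) := by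
  have hb1 : (1 : ℝ) ≤ b := by exact_mod_cast (by omega : 1 ≤ b)
  have key : ∀ i, i < T → ((b : ℝ) ^ T)⁻¹ ≤ ((b : ℝ) ^ (i + 1))⁻¹ := fun i hi =>
    inv_anti₀ (by positivity) (pow_le_pow_right₀ hb1 hi)
  obtain ⟨z, hz⟩ := exists_int_pow_mul_ofDigits (by omega) d n
  obtain ⟨i, hi, hiT, hi0⟩ := h₀
  obtain ⟨j, hj, hjT, hj0⟩ := h₁
  obtain ⟨i, rfl⟩ := Nat.exists_eq_add_of_le' hi
  obtain ⟨j, rfl⟩ := Nat.exists_eq_add_of_le' hj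
  rw [hz]
  refine le_distNearestInt_int_add (by positivity) z ?_ ?_
  · exact (key j (by omega)).trans (ofDigits_ge_of_ne_zero (fun i => d (i + n)) hj0)
  · have := ofDigits_le_of_eq_zero hb (fun i => d (i + n)) hi0
    linarith [key i (by omega)]

/-- A long run of digits `b - 1` in `d` after `p` could almost cancel the difference at `p`; the
zero at `q` prevents this. -/
lemma le_ofDigits_sub_ofDigits (hb : 2 ≤ b) (d e : ℕ → Fin b) {p q : ℕ} (hpq : p < q)
    (hlt : ∀ i < p, d i = e i) (hp : (d p : ℕ) < e p) (hq : (d q : ℕ) = 0) :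
    ((b : ℝ) ^ (q + 1))⁻¹ ≤ Real.ofDigits e - Real.ofDigits d := by
  rw [Real.ofDigits_eq_sum_add_ofDigits d (p + 1), Finset.sum_range_succ,
    Real.ofDigits_eq_sum_add_ofDigits e (p + 1), Finset.sum_range_succ]
  have h1 : ∑ j ∈ Finset.range p, Real.ofDigitsTerm e j =
      ∑ j ∈ Finset.range p, Real.ofDigitsTerm d j :=
    Finset.sum_congr rfl fun j hj => by
      simp [Real.ofDigitsTerm, hlt j (Finset.mem_range.1 hj)]
  obtain ⟨r, rfl⟩ : ∃ r, q = r + (p + 1) := ⟨q - (p + 1), by omega⟩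
  have h2 := ofDigits_le_of_eq_zero hb (fun i => d (i + (p + 1))) hq
  have h3 := Real.ofDigits_nonneg fun i => e (i + (p + 1))
  have h4 : Real.ofDigitsTerm d p + ((b : ℝ) ^ (p + 1))⁻¹ ≤ Real.ofDigitsTerm e p := by
    have : ((d p : ℕ) : ℝ) + 1 ≤ (e p : ℕ) := by exact_mod_cast hp
    have := mul_le_mul_of_nonneg_right this (by positivity : 0 ≤ ((b : ℝ) ^ (p + 1))⁻¹)
    rw [add_mul, one_mul] at this
    exact this
  have h5 : ((b : ℝ) ^ (r + (p + 1) + 1))⁻¹ =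
      ((b : ℝ) ^ (p + 1))⁻¹ * ((b : ℝ) ^ (r + 1))⁻¹ := by
    rw [← mul_inv, ← pow_add]; congr 2; omega
  have hpos : 0 ≤ ((b : ℝ) ^ (p + 1))⁻¹ := by positivity
  have h6 := mul_le_mul_of_nonneg_left h2 hpos
  have h7 := mul_nonneg hpos h3
  rw [h1, h5]
  linarith

lemma le_abs_ofDigits_sub_ofDigits (hb : 2 ≤ b) (d e : ℕ → Fin b) {p q : ℕ} (hpq : p < q)
    (hlt : ∀ i < p, d i = e i) (hp : d p ≠ e p) (hdq : (d q : ℕ) = 0) (heq : (e q : ℕ) = 0) :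
    ((b : ℝ) ^ (q + 1))⁻¹ ≤ |Real.ofDigits d - Real.ofDigits e| := by
  rcases lt_or_gt_of_ne hp with h | h
  · rw [abs_sub_comm]
    exact (le_ofDigits_sub_ofDigits hb d e hpq hlt h hdq).trans (le_abs_self _)
  · exact (le_ofDigits_sub_ofDigits hb e d hpq (fun i hi => (hlt i hi).symm) h heq).trans
      (le_abs_self _)

end Digits

/-! ### Dimension of a set with prescribed digits -/

section Fill

open Classical in
/-- The digit sequence which carries the terms of `ω`, in order, at the positions in `free`, and
the digits of `c` at the other positions. -/
noncomputable def fillDigits {b : ℕ} (free : ℕ → Prop) (c ω : ℕ → Fin b) (p : ℕ) : Fin b :=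
  if free p then ω (Nat.count free p) else c p

variable {b : ℕ} {free : ℕ → Prop} {c : ℕ → Fin b}

lemma fillDigits_of_not_free (ω : ℕ → Fin b) {p : ℕ} (hp : ¬ free p) :
    fillDigits free c ω p = c p := if_neg hp

open Classical in
lemma exists_first_difference (hinf : {p | free p}.Infinite) {ω ω' : ℕ → Fin b} (h : ω ≠ ω') :
    ∃ p, (∀ i < p, fillDigits free c ω i = fillDigits free c ω' i) ∧
      fillDigits free c ω p ≠ fillDigits free c ω' p ∧
      ∀ j < Nat.count free p, ω j = ω' j := by
  have hex : ∃ j, ω j ≠ ω' j := Function.ne_iff.1 h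
  have hne := Nat.find_spec hex
  have hmin : ∀ j < Nat.find hex, ω j = ω' j := fun j hj => not_not.1 (Nat.find_min hex hj)
  generalize Nat.find hex = i at hne hmin
  have hfree : free (Nat.nth free i) := Nat.nth_mem_of_infinite hinf i
  have hcount : Nat.count free (Nat.nth free i) = i := Nat.count_nth_of_infinite hinf i
  refine ⟨Nat.nth free i, fun q hq => ?_, ?_, ?_⟩
  · by_cases hfq : free q
    · have : Nat.count free q < i := by
        rw [← hcount]; exact Nat.count_strict_mono hfq hq
      simp [fillDigits, hfq, hmin _ this]
    · simp [fillDigits, hfq]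
  · simpa [fillDigits, hfree, hcount] using hne
  · rw [hcount]; exact hmin

open Classical in
/-- The numbers whose digits are prescribed outside `free` form a set of dimension at least the
lower density of `free`, if prescribed zeros occur with bounded gaps. -/
theorem le_dimH_range_fillDigits (hb : 2 ≤ b) {s C : ℝ} {M : ℕ} (hs : 0 < s)
    (hcount : ∀ p : ℕ, s * p ≤ Nat.count free p + C)
    (hzero : ∀ p, ∃ q, p < q ∧ q ≤ p + M ∧ ¬ free q ∧ (c q : ℕ) = 0) :
    ENNReal.ofReal s ≤ dimH (Set.range fun ω => Real.ofDigits (fillDigits free c ω)) := by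
  have hb1 : (1 : ℝ) < b := by exact_mod_cast (by omega : 1 < b)
  have hb0 : (0 : ℝ) < b := by linarith
  have hinf : {p | free p}.Infinite := by
    intro hfin
    obtain ⟨p, hp⟩ := exists_nat_gt ((hfin.toFinset.card + C) / s)
    rw [div_lt_iff₀ hs] at hp
    have h1 : (Nat.count free p : ℝ) ≤ hfin.toFinset.card := by
      exact_mod_cast Nat.count_le_card hfin p
    linarith [hcount p]
  set G : (ℕ → Fin b) → ℝ := fun ω => Real.ofDigits (fillDigits free c ω) with hG
  have key : ∀ ω ω', ω ≠ ω' → 0 < |G ω - G ω'| ∧ |Real.ofDigits ω - Real.ofDigits ω'| ≤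
      (b : ℝ) ^ (C + s * (M + 1)) * |G ω - G ω'| ^ s := by
    intro ω ω' hne
    obtain ⟨p, hlt, hp, hω⟩ := exists_first_difference (c := c) hinf hne
    obtain ⟨q, hpq, hqM, hqf, hq0⟩ := hzero p
    have hsep := le_abs_ofDigits_sub_ofDigits hb _ _ hpq hlt hp
      (by rw [fillDigits_of_not_free ω hqf, hq0]) (by rw [fillDigits_of_not_free ω' hqf, hq0])
    have hpos : 0 < ((b : ℝ) ^ (q + 1))⁻¹ := by positivity
    refine ⟨hpos.trans_le hsep, (Real.abs_ofDigits_sub_ofDigits_le hω).trans ?_⟩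
    calc ((b : ℝ) ^ Nat.count free p)⁻¹ = (b : ℝ) ^ (-(Nat.count free p : ℝ)) := by
          rw [Real.rpow_neg hb0.le, Real.rpow_natCast]
      _ ≤ (b : ℝ) ^ (C + s * (M + 1) + -((q : ℝ) + 1) * s) := by
          -- As `q ≤ p + M`, the density bound at `p` gives one at the separation scale `q`, with
          -- loss `s * (M + 1)`.
          refine Real.rpow_le_rpow_of_exponent_le hb1.le ?_
          have h1 : (q : ℝ) ≤ p + M := by exact_mod_cast hqM
          nlinarith [hcount p]
      _ = (b : ℝ) ^ (C + s * (M + 1)) * (((b : ℝ) ^ (q + 1))⁻¹) ^ s := by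
          rw [Real.rpow_add hb0, Real.rpow_mul hb0.le, Real.rpow_neg hb0.le]
          congr 3
          exact_mod_cast Real.rpow_natCast (b : ℝ) (q + 1)
      _ ≤ _ := by
          gcongr
  have hinj : Function.Injective G := by
    intro ω ω' h
    by_contra hne
    have := (key ω ω' hne).1
    rw [h, sub_self, abs_zero] at this
    exact this.false
  -- The decoding map `G ω ↦ Real.ofDigits ω`; its default value `0` off the range of `G` plays no
  -- role.
  have hext : ∀ ω, Function.extend G Real.ofDigits 0 (G ω) = Real.ofDigits ω :=
    fun ω => hinj.extend_apply _ _ ω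
  have hholder : HolderOnWith (Real.toNNReal ((b : ℝ) ^ (C + s * (M + 1)))) s.toNNReal
      (Function.extend G Real.ofDigits 0) (Set.range G) := by
    rintro _ ⟨ω, rfl⟩ _ ⟨ω', rfl⟩
    rw [hext, hext]
    by_cases hne : ω = ω'
    · simp [hne]
    · rw [edist_dist, edist_dist, Real.dist_eq, Real.dist_eq, Real.coe_toNNReal s hs.le,
        ENNReal.ofReal_rpow_of_pos (key ω ω' hne).1]
      change _ ≤ ENNReal.ofReal _ * _
      rw [← ENNReal.ofReal_mul (by positivity)]
      exact ENNReal.ofReal_le_ofReal (key ω ω' hne).2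
  have himage : Set.Icc (0 : ℝ) 1 ⊆ Function.extend G Real.ofDigits 0 '' Set.range G := by
    intro y hy
    obtain ⟨ω, -, rfl⟩ := Real.ofDigits_SurjOn (by omega : 1 < b) hy
    exact ⟨G ω, ⟨ω, rfl⟩, hext ω⟩
  have hs' : 0 < s.toNNReal := Real.toNNReal_pos.2 hs
  have hIcc : dimH (Set.Icc (0 : ℝ) 1) = 1 := by
    rw [Real.dimH_of_nonempty_interior (by simp [interior_Icc]), Module.finrank_self, Nat.cast_one]
  have h1 := (dimH_mono himage).trans (hholder.dimH_image_le hs')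
  rw [hIcc, ENNReal.le_div_iff_mul_le (Or.inl (by simpa using hs)) (Or.inl (by simp)),
    one_mul] at h1
  exact h1

end Fill

/-! ### Gaps, markers and the density of free positions -/

section Gaps

/-- The positions strictly between `M * α k` and `M * β k` for some `k`. -/
def InGap (M : ℕ) (α β : ℕ → ℕ) (p : ℕ) : Prop := ∃ k, M * α k < p ∧ p < M * β k

/-- The positions outside the gaps whose residue modulo `M` is neither `0` nor `1`. -/
def IsFree (M : ℕ) (α β : ℕ → ℕ) (p : ℕ) : Prop := ¬ InGap M α β p ∧ 2 ≤ p % M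

open Classical in
/-- The prescribed digits: `1` at the multiples of `M` outside the gaps, and `0` elsewhere. -/
noncomputable def markerDigits {b : ℕ} (hb : 2 ≤ b) (M : ℕ) (α β : ℕ → ℕ) (p : ℕ) : Fin b :=
  if ¬ InGap M α β p ∧ M ∣ p then ⟨1, hb⟩ else ⟨0, by omega⟩

variable {b M : ℕ} {α β : ℕ → ℕ}

lemma start_monotone (hαβ : ∀ k, α k < β k) (hβα : ∀ k, β k ≤ α (k + 1)) : Monotone α :=
  monotone_nat_of_le_succ fun k => (hαβ k).le.trans (hβα k)

lemma stop_monotone (hαβ : ∀ k, α k < β k) (hβα : ∀ k, β k ≤ α (k + 1)) : StrictMono β :=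
  strictMono_nat_of_lt_succ fun k => (hβα k).trans_lt (hαβ (k + 1))

lemma not_inGap (hαβ : ∀ k, α k < β k) (hβα : ∀ k, β k ≤ α (k + 1)) {k Q r : ℕ}
    (hkQ : β k ≤ Q) (hQk : Q < α (k + 1)) (hr : r < M) : ¬ InGap M α β (M * Q + r) := by
  rintro ⟨j, h1, h2⟩
  rcases Nat.lt_or_ge k j with h | h
  · have := Nat.mul_le_mul_left M
      ((Nat.succ_le_of_lt hQk).trans (start_monotone hαβ hβα (Nat.succ_le_of_lt h)))
    rw [Nat.mul_succ] at this
    omega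
  · have := Nat.mul_le_mul_left M (((stop_monotone hαβ hβα).monotone h).trans hkQ)
    omega

lemma not_inGap_stop (hαβ : ∀ k, α k < β k) (hβα : ∀ k, β k ≤ α (k + 1))
    (k : ℕ) : ¬ InGap M α β (M * β k) := by
  rintro ⟨j, h1, h2⟩
  have h3 := lt_of_mul_lt_mul_left' h1
  have h4 := (stop_monotone hαβ hβα).lt_iff_lt.1 (lt_of_mul_lt_mul_left' h2)
  have h5 := (hβα k).trans (start_monotone hαβ hβα (Nat.succ_le_of_lt h4))
  omega

section Digits

variable (hb : 2 ≤ b) (ω : ℕ → Fin b)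

lemma fillDigits_eq_zero_of_inGap {p : ℕ} (hp : InGap M α β p) :
    (fillDigits (IsFree M α β) (markerDigits hb M α β) ω p : ℕ) = 0 := by
  rw [fillDigits_of_not_free ω fun h => h.1 hp, markerDigits, if_neg fun h => h.1 hp]

lemma not_isFree_and_markerDigits_eq_zero {p : ℕ} (hp : p % M = 1) :
    ¬ IsFree M α β p ∧ (markerDigits hb M α β p : ℕ) = 0 := by
  refine ⟨fun h => by have := h.2; omega, ?_⟩
  rw [markerDigits, if_neg fun h => by have := Nat.mod_eq_zero_of_dvd h.2; omega]

lemma fillDigits_eq_one_of_dvd {p : ℕ} (hp : ¬ InGap M α β p) (hd : M ∣ p) :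
    (fillDigits (IsFree M α β) (markerDigits hb M α β) ω p : ℕ) = 1 := by
  have : p % M = 0 := Nat.mod_eq_zero_of_dvd hd
  rw [fillDigits_of_not_free ω fun h => by have := h.2; omega, markerDigits, if_pos ⟨hp, hd⟩]

lemma exists_mod_eq {M r : ℕ} (hr : r < M) (x : ℕ) : ∃ q, x ≤ q ∧ q < x + M ∧ q % M = r := by
  have h1 := Nat.mod_lt x (by omega : 0 < M)
  have h2 := Nat.div_add_mod x M
  by_cases h : x % M ≤ r
  · refine ⟨M * (x / M) + r, by omega, by omega, ?_⟩
    rw [Nat.mul_add_mod, Nat.mod_eq_of_lt hr]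
  · refine ⟨M * (x / M + 1) + r, by rw [Nat.mul_succ]; omega, by rw [Nat.mul_succ]; omega, ?_⟩
    rw [Nat.mul_add_mod, Nat.mod_eq_of_lt hr]

lemma distNearestInt_fillDigits_le {k n m : ℕ} (hn : M * α k < n) (hm : n + m ≤ M * β k) :
    distNearestInt ((b : ℝ) ^ n *
        Real.ofDigits (fillDigits (IsFree M α β) (markerDigits hb M α β) ω)) ≤
      ((b : ℝ) ^ m)⁻¹ := by
  refine (distNearestInt_pow_mul_ofDigits_le (by omega) _ n).trans
    (ofDigits_le_of_forall_lt_eq_zero _ fun i hi => ?_)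
  exact fillDigits_eq_zero_of_inGap hb ω ⟨k, by omega, by omega⟩

/-- The window of `T + M` digits after `x` meets a forced zero at residue `1`. It also meets a
forced `1`: at the next multiple of `M` or, if that lies in a gap, at the end of the gap. The bound
on `x` ensures that this gap has index at most `k`, so its length is at most `T`. -/
lemma le_distNearestInt_fillDigits (hM : 2 ≤ M) (hαβ : ∀ k, α k < β k)
    (hβα : ∀ k, β k ≤ α (k + 1)) {k x T : ℕ} (hx : x ≤ M * α (k + 1))
    (hT : ∀ j ≤ k, M * β j ≤ M * α j + T) :
    ((b : ℝ) ^ (T + M))⁻¹ ≤ distNearestInt ((b : ℝ) ^ x *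
        Real.ofDigits (fillDigits (IsFree M α β) (markerDigits hb M α β) ω)) := by
  refine le_distNearestInt_pow_mul_ofDigits hb _ _ _ ?_ ?_
  · obtain ⟨q, hxq, hqx, hq⟩ := exists_mod_eq (by omega : 1 < M) x
    obtain ⟨h1, h2⟩ := not_isFree_and_markerDigits_eq_zero (α := α) (β := β) hb hq
    exact ⟨q, hxq, by omega, by rw [fillDigits_of_not_free ω h1, h2]⟩
  · obtain ⟨q, hxq, hqx, hq⟩ := exists_mod_eq (by omega : 0 < M) x
    obtain ⟨Q, rfl⟩ := Nat.dvd_of_mod_eq_zero hq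
    by_cases hgap : InGap M α β (M * Q)
    · obtain ⟨j, h1, h2⟩ := hgap
      have hQ : Q ≤ α (k + 1) := by
        by_contra hcon
        have := Nat.mul_le_mul_left M (not_le.1 hcon)
        rw [Nat.mul_succ] at this
        omega
      have hj : j ≤ k := Nat.lt_succ_iff.1 <| (start_monotone hαβ hβα).reflect_lt <|
        (lt_of_mul_lt_mul_left' h1).trans_le hQ
      have := hT j hj
      refine ⟨M * β j, by omega, by omega, ?_⟩
      rw [fillDigits_eq_one_of_dvd hb ω (not_inGap_stop hαβ hβα j) (Nat.dvd_mul_right _ _)]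
      exact one_ne_zero
    · refine ⟨M * Q, hxq, by omega, ?_⟩
      rw [fillDigits_eq_one_of_dvd hb ω hgap (Nat.dvd_mul_right _ _)]
      exact one_ne_zero

end Digits

open Classical in
lemma count_isFree_between (hM : 2 ≤ M) (hαβ : ∀ k, α k < β k) (hβα : ∀ k, β k ≤ α (k + 1))
    {k Q : ℕ} (hkQ : β k ≤ Q) (hQk : Q ≤ α (k + 1)) :
    Nat.count (IsFree M α β) (M * β k) + (M - 2) * (Q - β k) ≤
      Nat.count (IsFree M α β) (M * Q) := by
  induction Q, hkQ using Nat.le_induction with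
  | base => simp
  | succ Q hkQ ih =>
    have h1 : Nat.count (fun r => IsFree M α β (M * Q + r)) M ≥ M - 2 := by
      obtain ⟨m, rfl⟩ := Nat.exists_eq_add_of_le hM
      have h2 : Nat.count (fun r => IsFree (2 + m) α β ((2 + m) * Q + (2 + r))) m = m := by
        rw [Nat.count_iff_forall]
        intro r hr
        refine ⟨not_inGap hαβ hβα hkQ hQk (by omega), ?_⟩
        rw [Nat.mul_add_mod, Nat.mod_eq_of_lt (by omega)]
        omega
      have h3 := Nat.count_add (fun r => IsFree (2 + m) α β ((2 + m) * Q + r)) 2 m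
      rw [h2] at h3
      omega
    have h4 := Nat.count_add (IsFree M α β) (M * Q) M
    have h5 := ih (by omega)
    have h6 : Q + 1 - β k = (Q - β k) + 1 := by omega
    rw [h6, Nat.mul_succ, Nat.mul_succ]
    omega

open Classical in
-- By `h`, the free positions between two gaps already pay for the whole next gap, so the bound at
-- gap ends follows by summation. Between gaps the density `(M - 2) / M` is at least `s`; inside a
-- gap one compares with its end.
theorem le_count_isFree {s : ℝ} (hs : 0 ≤ s) (hM : 2 ≤ M) (hαβ : ∀ k, α k < β k)
    (hβα : ∀ k, β k ≤ α (k + 1)) (hsM : s * M ≤ M - 2)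
    (h : ∀ k, s * (M * (β (k + 1) - β k : ℝ)) ≤ (M - 2) * (α (k + 1) - β k : ℝ)) (p : ℕ) :
    s * p ≤ Nat.count (IsFree M α β) p + s * (M * (β 0 + 1)) := by
  have hM2 : ((M - 2 : ℕ) : ℝ) = M - 2 := by push_cast [hM]; ring
  have between : ∀ k Q, β k ≤ Q → Q ≤ α (k + 1) →
      (Nat.count (IsFree M α β) (M * β k) : ℝ) + (M - 2) * (Q - β k) ≤
        Nat.count (IsFree M α β) (M * Q) := by
    intro k Q h1 h2
    have := count_isFree_between hM hαβ hβα h1 h2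
    rw [← hM2, ← Nat.cast_sub h1]
    exact_mod_cast this
  have mono : ∀ {x y : ℕ}, x ≤ y →
      (Nat.count (IsFree M α β) x : ℝ) ≤ Nat.count (IsFree M α β) y := fun hxy => by
    exact_mod_cast Nat.count_monotone _ hxy
  have hstart : ∀ k, s * (M * β k) ≤ Nat.count (IsFree M α β) (M * α k) + s * (M * β 0) := by
    intro k
    induction k with
    | zero => linarith [Nat.cast_nonneg (α := ℝ) (Nat.count (IsFree M α β) (M * α 0))]
    | succ k ih =>
      have h1 := between k _ (hβα k) le_rfl
      have h2 := mono (Nat.mul_le_mul_left M (hαβ k).le)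
      linarith [h k]
  have hM0 : (0 : ℝ) < M := by exact_mod_cast (by omega : 0 < M)
  have hsM0 : 0 ≤ s * M := by positivity
  rcases Nat.lt_or_ge p (M * β 0) with hp | hp
  · have h1 : (p : ℝ) ≤ M * β 0 := by exact_mod_cast hp.le
    have h2 := mul_le_mul_of_nonneg_left h1 hs
    have h3 := Nat.cast_nonneg (α := ℝ) (Nat.count (IsFree M α β) p)
    linarith
  have hex : ∃ k, p < M * β k := by
    refine ⟨p + 1, (Nat.lt_succ_self p).trans_le ?_⟩
    exact ((stop_monotone hαβ hβα).le_apply).trans (Nat.le_mul_of_pos_left _ (by omega))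
  obtain ⟨k, hk⟩ : ∃ k, Nat.find hex = k + 1 := by
    refine Nat.exists_eq_succ_of_ne_zero fun h0 => ?_
    have := Nat.find_spec hex
    rw [h0] at this
    omega
  have hpk : p < M * β (k + 1) := hk ▸ Nat.find_spec hex
  have hkp : M * β k ≤ p := not_lt.1 (Nat.find_min hex (by omega))
  rcases Nat.lt_or_ge p (M * α (k + 1)) with hα | hα
  · have h1 : β k ≤ p / M := (Nat.le_div_iff_mul_le (by omega)).2 (by rwa [mul_comm])
    have h2 : p / M ≤ α (k + 1) := (Nat.div_lt_of_lt_mul hα).le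
    have h3 := between k _ h1 h2
    have h4 := mono (Nat.mul_div_le p M)
    have h5 := mono (Nat.mul_le_mul_left M (hαβ k).le)
    have h6 : (p : ℝ) ≤ M * (p / M : ℕ) + M := by
      have := Nat.lt_mul_div_succ p (by omega : 0 < M)
      rw [Nat.mul_succ] at this
      exact_mod_cast this.le
    have h7 := mul_le_mul_of_nonneg_left h6 hs
    have h8 : (0 : ℝ) ≤ (p / M : ℕ) - β k := by
      have : (β k : ℝ) ≤ (p / M : ℕ) := by exact_mod_cast h1
      linarith
    have h9 := mul_le_mul_of_nonneg_right hsM h8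
    linarith [hstart k]
  · have h1 : (p : ℝ) ≤ M * β (k + 1) := by exact_mod_cast hpk.le
    have h2 := mul_le_mul_of_nonneg_left h1 hs
    linarith [hstart (k + 1), mono hα]

theorem le_dimH_range_gapDigits (hb : 2 ≤ b) {s : ℝ} (hs : 0 < s) (hM : 2 ≤ M)
    (hαβ : ∀ k, α k < β k) (hβα : ∀ k, β k ≤ α (k + 1)) (hsM : s * M ≤ M - 2)
    (h : ∀ k, s * (M * (β (k + 1) - β k : ℝ)) ≤ (M - 2) * (α (k + 1) - β k : ℝ)) :
    ENNReal.ofReal s ≤ dimH (Set.range fun ω =>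
      Real.ofDigits (fillDigits (IsFree M α β) (markerDigits hb M α β) ω)) := by
  classical
  refine le_dimH_range_fillDigits (C := s * (M * (β 0 + 1))) (M := M) hb hs (fun p => ?_) fun p => ?_
  · convert le_count_isFree hs.le hM hαβ hβα hsM h p
  · obtain ⟨q, h1, h2, h3⟩ := exists_mod_eq (by omega : 1 < M) (p + 1)
    exact ⟨q, by omega, by omega, not_isFree_and_markerDigits_eq_zero hb h3⟩

end Gaps

/-! ### Irrationality and the exact exponent from block estimates -/

section Exponent

variable {b : ℕ} {a : ℕ → ℕ} {v ξ : ℝ} {k₀ l : ℕ}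

lemma tendsto_block_end (ha : StrictMono a) (l : ℕ) :
    Tendsto (fun k => a (k * (l + 1) + l)) atTop atTop :=
  ha.tendsto_atTop.comp <| tendsto_atTop_mono
    (fun k => (Nat.le_mul_of_pos_right k l.succ_pos).trans (Nat.le_add_right _ l)) tendsto_id

lemma tendsto_pow_block_end_rpow_neg (hb : 2 ≤ b) (ha : StrictMono a) (hv : 0 < v) (l : ℕ) :
    Tendsto (fun k => ((b : ℝ) ^ a (k * (l + 1) + l)) ^ (-v)) atTop (𝓝 0) :=
  (tendsto_rpow_neg_atTop hv).comp <|
    (tendsto_pow_atTop_atTop_of_one_lt (by exact_mod_cast (by omega : 1 < b))).comp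
      (tendsto_block_end ha l)

lemma inv_den_le_distNearestInt (n : ℕ) (r : ℚ)
    (h : 0 < distNearestInt ((b : ℝ) ^ n * r)) :
    ((r.den : ℝ))⁻¹ ≤ distNearestInt ((b : ℝ) ^ n * r) := by
  have hden : (0 : ℝ) < r.den := by exact_mod_cast r.den_pos
  unfold distNearestInt at h ⊢
  generalize round ((b : ℝ) ^ n * (r : ℝ)) = z at h ⊢
  have hr : (b : ℝ) ^ n * (r : ℝ) - z = (((b : ℤ) ^ n * r.num - z * r.den : ℤ) : ℝ) / r.den := by
    rw [Rat.cast_def]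
    push_cast
    field_simp
  rw [hr, abs_div, abs_of_pos hden] at h ⊢
  rw [inv_eq_one_div]
  refine div_le_div_of_nonneg_right ?_ hden.le
  have h1 : 0 < |(((b : ℤ) ^ n * r.num - z * r.den : ℤ) : ℝ)| := by
    by_contra hcon
    rw [le_antisymm (not_lt.1 hcon) (abs_nonneg _), zero_div] at h
    exact h.false
  rw [← Int.cast_abs] at h1 ⊢
  exact_mod_cast Int.add_one_le_iff.2 (by exact_mod_cast h1 : (0 : ℤ) < _)

/-- For a rational number, the nonzero distances are at least the inverse of its denominator, but
here they are positive and become arbitrarily small. -/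
theorem irrational_of_approximation (hb : 2 ≤ b) (ha : StrictMono a) (hv : 0 < v)
    (hle : ∀ k ≥ k₀, distNearestInt ((b : ℝ) ^ a (k * (l + 1)) * ξ) <
      ((b : ℝ) ^ a (k * (l + 1) + l)) ^ (-v))
    (hpos : ∀ n, 0 < distNearestInt ((b : ℝ) ^ a n * ξ)) : Irrational ξ := by
  rintro ⟨r, rfl⟩
  have hden : (0 : ℝ) < (r.den : ℝ)⁻¹ := by
    have := r.den_pos
    positivity
  obtain ⟨k, hk, hk₀⟩ := (((tendsto_pow_block_end_rpow_neg hb ha hv l).eventually_lt_const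
    hden).and (eventually_ge_atTop k₀)).exists
  linarith [hle k hk₀, inv_den_le_distNearestInt _ r (hpos (k * (l + 1)))]

/-- The first term of a block serves every `N` in the block, because the bound is calibrated to the
block's last term. Testing at that last term excludes every `w > v`, since `(w - v) * a N`
eventually exceeds the constant `T`. -/
theorem uniformExponent_eq_of_approximation (hb : 2 ≤ b) (ha : StrictMono a) (hv : 0 < v)
    (hle : ∀ k ≥ k₀, distNearestInt ((b : ℝ) ^ a (k * (l + 1)) * ξ) <
      ((b : ℝ) ^ a (k * (l + 1) + l)) ^ (-v))
    {T : ℝ} (hge : ∀ k ≥ k₀, ∀ n ≤ k * (l + 1) + l,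
      (b : ℝ) ^ (-(v * a (k * (l + 1) + l) + T)) ≤ distNearestInt ((b : ℝ) ^ a n * ξ)) :
    uniformExponent b a ξ = ENNReal.ofReal v := by
  have hb1 : (1 : ℝ) < b := by exact_mod_cast (by omega : 1 < b)
  refine le_antisymm (iSup₂_le fun w hw => ?_) ?_
  · by_contra hcon
    have hvw : v < w := by
      by_contra h
      refine hcon ?_
      rw [← ENNReal.ofReal_coe_nnreal]
      exact ENNReal.ofReal_le_ofReal (not_lt.1 h)
    obtain ⟨N₀, hN₀⟩ := eventually_atTop.1 hw
    have hlim : Tendsto (fun k => (w - v) * (a (k * (l + 1) + l) : ℝ)) atTop atTop :=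
      (tendsto_natCast_atTop_atTop.comp (tendsto_block_end ha l)).const_mul_atTop
        (sub_pos.2 hvw)
    obtain ⟨k, hk, hk'⟩ := ((hlim.eventually_ge_atTop T).and
      (eventually_ge_atTop (max k₀ N₀))).exists
    have hN : N₀ ≤ k * (l + 1) + l :=
      (le_max_right k₀ N₀).trans <| hk'.trans <|
        (Nat.le_mul_of_pos_right k l.succ_pos).trans (Nat.le_add_right _ _)
    obtain ⟨n, hn, hlt⟩ := hN₀ _ hN
    refine (((hge k ((le_max_left _ _).trans hk') n hn).trans_lt hlt).trans_le ?_).false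
    rw [← Real.rpow_natCast, ← Real.rpow_mul (by positivity)]
    refine Real.rpow_le_rpow_of_exponent_le hb1.le ?_
    linarith
  · refine le_iSup₂_of_le v.toNNReal ?_ le_rfl
    rw [Real.coe_toNNReal v hv.le]
    filter_upwards [eventually_ge_atTop ((k₀ + 1) * (l + 1))] with N hN
    have hdiv := Nat.div_add_mod N (l + 1)
    have hmod := Nat.mod_lt N (by omega : 0 < l + 1)
    rw [mul_comm] at hdiv
    have hk : k₀ ≤ N / (l + 1) := by
      rw [Nat.le_div_iff_mul_le l.succ_pos]
      exact (Nat.mul_le_mul_right _ k₀.le_succ).trans hN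
    refine ⟨N / (l + 1) * (l + 1), by omega, (hle _ hk).trans_le ?_⟩
    refine Real.rpow_le_rpow_of_nonpos (by positivity) ?_ (by linarith)
    exact pow_le_pow_right₀ hb1.le (ha.monotone (by omega))

end Exponent

/-! ### Asymptotics of the sequence over one block -/

section Growth

variable {a : ℕ → ℕ} {η : ℝ}

lemma tendsto_ratio_shift (ha_pos : ∀ n, 0 < a n)
    (hη : Tendsto (fun n : ℕ => (a (n + 1) : ℝ) / (a n : ℝ)) atTop (𝓝 η)) (j : ℕ) :
    Tendsto (fun n : ℕ => (a (n + j) : ℝ) / (a n : ℝ)) atTop (𝓝 (η ^ j)) := by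
  have h0 : ∀ n, (a n : ℝ) ≠ 0 := fun n => by exact_mod_cast (ha_pos n).ne'
  induction j with
  | zero => simp [h0]
  | succ j ih =>
    rw [pow_succ']
    refine ((hη.comp (tendsto_add_atTop_nat j)).mul ih).congr fun n => ?_
    have := h0 n
    have := h0 (n + j)
    simp only [Function.comp_apply, ← add_assoc]
    field_simp

lemma tendsto_const_div (ha : StrictMono a) (c : ℝ) :
    Tendsto (fun n : ℕ => c / (a n : ℝ)) atTop (𝓝 0) :=
  (tendsto_natCast_atTop_atTop.comp ha.tendsto_atTop).const_div_atTop c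

lemma eventually_add_le_succ (ha_pos : ∀ n, 0 < a n) (ha : StrictMono a)
    (hη : Tendsto (fun n : ℕ => (a (n + 1) : ℝ) / (a n : ℝ)) atTop (𝓝 η)) (hη_one : 1 < η)
    (m : ℕ) : ∀ᶠ n in atTop, a n + m ≤ a (n + 1) := by
  have h := (hη.sub (tendsto_const_div ha m)).eventually_const_lt (by rwa [sub_zero])
  filter_upwards [h] with n hn
  have h0 : (0 : ℝ) < a n := by exact_mod_cast ha_pos n
  rw [← sub_div, lt_div_iff₀ h0] at hn
  have : (a n : ℝ) + m < a (n + 1) := by linarith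
  exact_mod_cast this.le

/-- After division by `a n`, both inequalities become strict in the limit, and the constants, which
absorb the rounding to multiples of `M`, disappear. -/
lemma eventually_block_inequalities (ha_pos : ∀ n, 0 < a n) (ha : StrictMono a)
    (hη : Tendsto (fun n : ℕ => (a (n + 1) : ℝ) / (a n : ℝ)) atTop (𝓝 η)) {v s M : ℝ} {l : ℕ}
    (hP : 0 < η ^ (l + 1) - 1 - η ^ l * v)
    (hM : s * M * ((η ^ (l + 1) - 1) * (1 + η ^ l * v)) <
      (M - 2) * (η ^ (l + 1) - 1 - η ^ l * v)) :
    ∀ᶠ n in atTop, (a n : ℝ) + v * a (n + l) + (2 * M + 1) ≤ a (n + l + 1) ∧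
      s * M * (a (n + l + 1) + v * a (n + l + 1 + l) + (M + 1) - (a n + v * a (n + l))) ≤
        (M - 2) * (a (n + l + 1) - (a n + v * a (n + l) + (2 * M + 1))) := by
  have r := tendsto_ratio_shift ha_pos hη
  have h0 : ∀ n, (0 : ℝ) < a n := fun n => by exact_mod_cast ha_pos n
  have h1 : Tendsto (fun n => ((a (n + l + 1) : ℝ) - (a n + v * a (n + l) + (2 * M + 1))) / a n)
      atTop (𝓝 (η ^ (l + 1) - 1 - η ^ l * v)) := by
    have := (((r (l + 1)).sub_const 1).sub ((r l).mul_const v)).sub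
      (tendsto_const_div ha (2 * M + 1))
    rw [sub_zero] at this
    refine this.congr fun n => ?_
    have := (h0 n).ne'
    rw [← add_assoc]
    field_simp
    ring
  have h2 : Tendsto (fun n => ((a (n + l + 1) : ℝ) + v * a (n + l + 1 + l) + (M + 1) -
      (a n + v * a (n + l))) / a n) atTop (𝓝 ((η ^ (l + 1) - 1) * (1 + η ^ l * v))) := by
    have := ((((r (l + 1)).add ((r (l + 1 + l)).mul_const v)).add
      (tendsto_const_div ha (M + 1))).sub_const 1).sub ((r l).mul_const v)
    convert this using 2 with n
    · have := (h0 n).ne'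
      simp only [← add_assoc]
      field_simp
      ring
    · ring
  have h3 := ((h1.const_mul (M - 2)).sub (h2.const_mul (s * M))).eventually_const_lt
    (sub_pos.2 hM)
  filter_upwards [h1.eventually_const_lt hP, h3] with n hn1 hn2
  rw [← mul_div_assoc, ← mul_div_assoc, ← sub_div] at hn2
  have hn1' := (div_pos_iff_of_pos_right (h0 n)).1 hn1
  have hn2' := (div_pos_iff_of_pos_right (h0 n)).1 hn2
  constructor <;> linarith

end Growth

/-! ### The construction and the conclusion -/

section Construction

/-- If `0 < s` is less than the quotient in question, the level set has dimension at least `s`. -/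
theorem ofReal_le_dimH_uniformExponentLevelSet {b : ℕ} (hb : 2 ≤ b) {a : ℕ → ℕ}
    (ha_pos : ∀ n, 0 < a n) (ha : StrictMono a) {η : ℝ}
    (hη : Tendsto (fun n : ℕ => (a (n + 1) : ℝ) / (a n : ℝ)) atTop (𝓝 η)) (hη_one : 1 < η)
    {v : ℝ} (hv : 0 < v) (l : ℕ) {s : ℝ} (hs : 0 < s)
    (hsl : s * ((η ^ (l + 1) - 1) * (1 + η ^ l * v)) < η ^ (l + 1) - 1 - η ^ l * v) :
    ENNReal.ofReal s ≤ dimH (uniformExponentLevelSet b a (ENNReal.ofReal v)) := by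
  have hη0 : 0 < η := by linarith
  have hpow : 1 < η ^ (l + 1) := one_lt_pow₀ hη_one l.succ_ne_zero
  have hQ : 0 < (η ^ (l + 1) - 1) * (1 + η ^ l * v) :=
    mul_pos (by linarith) (by positivity)
  have hP : 0 < η ^ (l + 1) - 1 - η ^ l * v := (mul_pos hs hQ).trans hsl
  -- The right side minus the left is `η ^ (l + 1) * (η ^ l * v)`.
  have hPQ : η ^ (l + 1) - 1 - η ^ l * v ≤ (η ^ (l + 1) - 1) * (1 + η ^ l * v) := by
    have : 0 ≤ η ^ (l + 1) * (η ^ l * v) := by positivity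
    nlinarith
  -- With `P / Q` the target quotient, `M > 2 * P / (P - s * Q)` is equivalent to `s * M * Q < (M -
  -- 2) * P`.
  obtain ⟨M, hMlarge⟩ := exists_nat_gt (max 2 (2 * (η ^ (l + 1) - 1 - η ^ l * v) /
    (η ^ (l + 1) - 1 - η ^ l * v - s * ((η ^ (l + 1) - 1) * (1 + η ^ l * v)))))
  have hM2r : (2 : ℝ) < M := (le_max_left _ _).trans_lt hMlarge
  have hM2 : 2 < M := by exact_mod_cast hM2r
  have hM0 : 0 < M := by omega
  have hM : s * M * ((η ^ (l + 1) - 1) * (1 + η ^ l * v)) <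
      (M - 2) * (η ^ (l + 1) - 1 - η ^ l * v) := by
    have := (le_max_right _ _).trans_lt hMlarge
    rw [div_lt_iff₀ (sub_pos.2 hsl)] at this
    linarith
  have hsM : s * M ≤ M - 2 := by
    have := hM.trans_le (mul_le_mul_of_nonneg_left hPQ (by linarith))
    exact (lt_of_mul_lt_mul_right this hQ.le).le
  obtain ⟨n₀, hn₀⟩ := eventually_atTop.1
    ((eventually_block_inequalities ha_pos ha hη hP hM).and
      ((tendsto_add_atTop_nat l).eventually
        (eventually_add_le_succ ha_pos ha hη hη_one (M + 1))))
  set S : ℕ → ℕ := fun k => (k + n₀) * (l + 1) with hS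
  have hSn : ∀ k, n₀ ≤ S k := fun k =>
    (Nat.le_add_left _ _).trans (Nat.le_mul_of_pos_right _ l.succ_pos)
  have hSs : ∀ k, S (k + 1) = S k + l + 1 := fun k => by simp only [hS]; ring
  -- Rounding outwards to multiples of `M`: the open gap contains `⌈v * a (S k + l)⌉₊ + 1` positions
  -- starting at `a (S k)`. The extra one makes the approximation strict.
  set α : ℕ → ℕ := fun k => (a (S k) - 1) / M with hα
  set β : ℕ → ℕ := fun k => (a (S k) + ⌈v * a (S k + l)⌉₊) / M + 1 with hβ
  have hα1 : ∀ k, M * α k + 1 ≤ a (S k) := fun k => by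
    have := Nat.mul_div_le (a (S k) - 1) M
    have := ha_pos (S k)
    simp only [hα]
    omega
  have hα2 : ∀ k, a (S k) ≤ M * α k + M := fun k => by
    have := Nat.lt_mul_div_succ (a (S k) - 1) hM0
    simp only [hα]
    rw [Nat.mul_succ] at this
    omega
  have hβ1 : ∀ k, a (S k) + ⌈v * a (S k + l)⌉₊ + 1 ≤ M * β k := fun k =>
    Nat.lt_mul_div_succ _ hM0
  have hβ2 : ∀ k, M * β k ≤ a (S k) + ⌈v * a (S k + l)⌉₊ + M := fun k => by
    simp only [hβ]
    rw [Nat.mul_succ]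
    exact Nat.add_le_add_right (Nat.mul_div_le _ _) _
  have hα1r : ∀ k, (M : ℝ) * α k + 1 ≤ a (S k) := fun k => by exact_mod_cast hα1 k
  have hα2r : ∀ k, (a (S k) : ℝ) ≤ M * α k + M := fun k => by exact_mod_cast hα2 k
  have hβ1r : ∀ k, (a (S k) : ℝ) + v * a (S k + l) + 1 ≤ M * β k := fun k => by
    have h1 : (a (S k) : ℝ) + ⌈v * a (S k + l)⌉₊ + 1 ≤ M * β k := by exact_mod_cast hβ1 k
    linarith [Nat.le_ceil (v * (a (S k + l) : ℝ))]
  have hβ2r : ∀ k, (M : ℝ) * β k ≤ a (S k) + v * a (S k + l) + 1 + M := fun k => by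
    have h1 : (M : ℝ) * β k ≤ a (S k) + ⌈v * a (S k + l)⌉₊ + M := by exact_mod_cast hβ2 k
    have h2 := Nat.ceil_lt_add_one (by positivity : 0 ≤ v * (a (S k + l) : ℝ))
    linarith
  have hαβ : ∀ k, α k < β k := fun k => by
    refine lt_of_mul_lt_mul_left' (a := M) ?_
    have := hα1 k
    have := hβ1 k
    omega
  have hM0r : (0 : ℝ) < M := by linarith
  have hgap : ∀ k, (a (S k) : ℝ) + v * a (S k + l) + (2 * M + 1) ≤ a (S (k + 1)) := fun k => by
    rw [hSs]
    exact (hn₀ (S k) (hSn k)).1.1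
  have hβα : ∀ k, β k ≤ α (k + 1) := fun k => by
    have : (M : ℝ) * β k ≤ M * α (k + 1) := by
      linarith [hβ2r k, hα2r (k + 1), hgap k]
    exact_mod_cast le_of_mul_le_mul_left this hM0r
  have hdens : ∀ k, s * (M * (β (k + 1) - β k : ℝ)) ≤ (M - 2) * (α (k + 1) - β k : ℝ) := by
    intro k
    have h1 := (hn₀ (S k) (hSn k)).1.2
    rw [← hSs] at h1
    have h2 : (M : ℝ) * (β (k + 1) - β k) ≤ a (S (k + 1)) + v * a (S (k + 1) + l) + (M + 1) -
        (a (S k) + v * a (S k + l)) := by linarith [hβ2r (k + 1), hβ1r k]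
    have h3 : (a (S (k + 1)) : ℝ) - (a (S k) + v * a (S k + l) + (2 * M + 1)) ≤
        M * (α (k + 1) - β k) := by linarith [hα2r (k + 1), hβ2r k]
    have h4 := mul_le_mul_of_nonneg_left h2 (by positivity : 0 ≤ s * M)
    have h5 := mul_le_mul_of_nonneg_left h3 (by linarith : 0 ≤ (M : ℝ) - 2)
    refine le_of_mul_le_mul_left ?_ hM0r
    linarith
  refine (le_dimH_range_gapDigits hb hs hM2.le hαβ hβα hsM hdens).trans (dimH_mono ?_)
  rintro _ ⟨ω, rfl⟩
  have hb1 : (1 : ℝ) < b := by exact_mod_cast (by omega : 1 < b)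
  have hle : ∀ k ≥ n₀, distNearestInt ((b : ℝ) ^ a (k * (l + 1)) *
      Real.ofDigits (fillDigits (IsFree M α β) (markerDigits hb M α β) ω)) <
        ((b : ℝ) ^ a (k * (l + 1) + l)) ^ (-v) := by
    intro k hk
    obtain ⟨k, rfl⟩ := Nat.exists_eq_add_of_le' hk
    refine (distNearestInt_fillDigits_le (m := ⌈v * a (S k + l)⌉₊ + 1) hb ω (hα1 k)
      (hβ1 k)).trans_lt ?_
    rw [← Real.rpow_natCast, ← Real.rpow_natCast, ← Real.rpow_neg (by positivity),
      ← Real.rpow_mul (by positivity)]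
    refine Real.rpow_lt_rpow_of_exponent_lt hb1 ?_
    push_cast
    have := Nat.le_ceil (v * (a (S k + l) : ℝ))
    simp only [hS] at this ⊢
    linarith
  have hge : ∀ k ≥ n₀, ∀ n ≤ k * (l + 1) + l,
      (b : ℝ) ^ (-(v * a (k * (l + 1) + l) + (3 * M + 1))) ≤ distNearestInt ((b : ℝ) ^ a n *
        Real.ofDigits (fillDigits (IsFree M α β) (markerDigits hb M α β) ω)) := by
    intro k hk n hn
    obtain ⟨k, rfl⟩ := Nat.exists_eq_add_of_le' hk
    have hx : a n ≤ M * α (k + 1) := by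
      have h1 := (hn₀ (S k) (hSn k)).2
      rw [← hSs] at h1
      have h2 := hα2 (k + 1)
      have h3 : a n ≤ a (S k + l) := ha.monotone hn
      omega
    -- Rounding lengthens a gap by at most `M` at each end, whence `2 * M`; the longest gap up to
    -- `k` is controlled by the last.
    refine le_trans ?_ (le_distNearestInt_fillDigits hb ω hM2.le hαβ hβα hx
      (T := ⌈v * a (S k + l)⌉₊ + 2 * M) fun j hj => ?_)
    · rw [← Real.rpow_natCast, ← Real.rpow_neg (by positivity)]
      refine Real.rpow_le_rpow_of_exponent_le hb1.le ?_
      push_cast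
      have := Nat.ceil_lt_add_one (by positivity : 0 ≤ v * (a (S k + l) : ℝ))
      simp only [hS] at this ⊢
      linarith
    · have h1 : ⌈v * (a (S j + l) : ℝ)⌉₊ ≤ ⌈v * (a (S k + l) : ℝ)⌉₊ := by
        refine Nat.ceil_mono (mul_le_mul_of_nonneg_left ?_ hv.le)
        have : S j ≤ S k := Nat.mul_le_mul_right _ (Nat.add_le_add_right hj _)
        exact_mod_cast ha.monotone (Nat.add_le_add_right this l)
      have h2 := hβ2 j
      have h3 := hα2 j
      omega
  refine ⟨irrational_of_approximation hb ha hv hle fun n => ?_,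
    uniformExponent_eq_of_approximation hb ha hv hle hge⟩
  refine lt_of_lt_of_le ?_ (hge (max n n₀) (le_max_right _ _) n ?_)
  · positivity
  · exact (le_max_left n n₀).trans <|
      (Nat.le_mul_of_pos_right _ l.succ_pos).trans (Nat.le_add_right _ l)

end Construction

theorem theorem13 (b : ℕ) (hb : 2 ≤ b) (a : ℕ → ℕ) (ha_pos : ∀ n, 0 < a n)
    (ha_mono : StrictMono a) (η : ℝ)
    (hη : Tendsto (fun n : ℕ => (a (n + 1) : ℝ) / (a n : ℝ)) atTop (𝓝 η)) (hη_one : 1 < η)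
    (v : ℝ) (hv_pos : 0 < v) (hv_lt : v < η) :
    ENNReal.ofReal
        ((η ^ (lTilde η v + 1) - 1 - η ^ lTilde η v * v) /
          ((η ^ (lTilde η v + 1) - 1) * (1 + η ^ lTilde η v * v))) ≤
      dimH (uniformExponentLevelSet b a (ENNReal.ofReal v)) := by
  generalize lTilde η v = l
  have hQ : 0 < (η ^ (l + 1) - 1) * (1 + η ^ l * v) := by
    have hη0 : 0 < η := by linarith
    exact mul_pos (sub_pos.2 (one_lt_pow₀ hη_one l.succ_ne_zero)) (by positivity)
  -- Staying strictly below the quotient leaves room for the factor `(M - 2) / M`.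
  refine ENNReal.le_of_forall_nnreal_lt fun s hs => ?_
  rcases eq_or_ne s 0 with rfl | hs0
  · simp
  rw [← ENNReal.ofReal_coe_nnreal] at hs ⊢
  have hs_pos : (0 : ℝ) < s := by exact_mod_cast pos_iff_ne_zero.2 hs0
  rw [ENNReal.ofReal_lt_ofReal_iff_of_nonneg hs_pos.le, lt_div_iff₀ hQ] at hs
  exact ofReal_le_dimH_uniformExponentLevelSet hb ha_pos ha_mono hη hη_one hv_pos l hs_pos hs
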